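/- Let $k\ge 2$ and $\Sigma_k=\{0,1,\dots,k-1\}$. A necklace of length $N$ over $\Sigma_k$ is a class of words of length $N$ over $\Sigma_k$ up to cyclic rotation. The Burrows--Wheeler transform (BWT) of a necklace $[w]$ is the last column of the matrix whose rows are the $|w|$ rotations of $w$ (listed with multiplicity) in ascending lexicographic order. For $n\ge1$, a necklace of length $kn$ over $\Sigma_k$ is a generalized de Bruijn word if its BWT is a concatenation of one or more words each of which contains every letter of $\Sigma_k$ exactly once. The generalized de Bruijn graph $\mathrm{DB}(k,n)$ is the directed multigraph with vertex set $\{0,1,\dots,n-1\}$ having, for every vertex $m$ and every $i\in\{0,1,\dots,k-1\}$, an edge from $m$ to $(km+i) \bmod n$ (these $k$ edges are distinct, even if parallel). An oriented spanning tree with root $r$ is a spanning subgraph without directed cycles in which $r$ has outdegree $0$ and every other vertex has outdegree $1$. **Theorem.** For every $k\ge2$, every $n\ge 1$ and every vertex $r$ of $\mathrm{DB}(k,n)$, the number of generalized de Bruijn words of length $kn$ over $\Sigma_k$ is $$\big((k-1)!\big)^n\cdot\kappa(\mathrm{DB}(k,n)),$$ where $\kappa(\mathrm{DB}(k,n))$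 is the number of oriented spanning trees of $\mathrm{DB}(k,n)$ with root $r$ (in particular, this number does not depend on $r$). -/

import Mathlib

/-- An alphabet-permutation over `Σ_k = {0, …, k-1}`: a word containing each letter exactly once. -/
def IsAlphabetPermutation {k : ℕ} (w : List (Fin k)) : Prop :=
  ∀ a : Fin k, w.count a = 1

/-- An alphabet-permutation power: a concatenation of one or more alphabet-permutations. -/
def IsAlphabetPermutationPower {k : ℕ} (w : List (Fin k)) : Prop :=
  ∃ L : List (List (Fin k)), L ≠ [] ∧ (∀ u ∈ L, IsAlphabetPermutation u) ∧ L.flatten = w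

/-- A necklace over `Σ_k` is a conjugacy class of words, i.e. a term of `Cycle (Fin k)`.
The rows of its Burrows–Wheeler matrix are the shifts of any of its representatives, listed with
multiplicity, in ascending lexicographic order. -/
def bwtMatrix {k : ℕ} (c : Cycle (Fin k)) : List (List (Fin k)) :=
  c.lists.sort (· ≤ ·)

/-- The Burrows–Wheeler transform: the last column of the Burrows–Wheeler matrix. (`filterMap` only
serves to skip the single, empty row that Mathlib assigns to the empty necklace.) -/
def bwt {k : ℕ} (c : Cycle (Fin k)) : List (Fin k) :=
  (bwtMatrix c).filterMap List.getLast?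

/-- A generalized de Bruijn word of length `k * n` over `Σ_k`: a necklace of length `k * n`
whose Burrows–Wheeler transform is an alphabet-permutation power. -/
def IsGeneralizedDeBruijnWord (k n : ℕ) (c : Cycle (Fin k)) : Prop :=
  c.length = k * n ∧ IsAlphabetPermutationPower (bwt c)

/-- A directed graph with vertex set `V` and edge set `E`; loops and multiple edges are allowed. -/
structure DirectedMultigraph (V E : Type*) where
  /-- the source vertex of an edge -/
  source : E → V
  /-- the target vertex of an edge -/
  target : E → V

namespace DirectedMultigraph

variable {V E : Type*}

/-- There is an edge from `v` to `w` that belongs to the edge set `T`. -/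
def Step (G : DirectedMultigraph V E) (T : Set E) (v w : V) : Prop :=
  ∃ e ∈ T, G.source e = v ∧ G.target e = w

/-- The spanning subgraph with edge set `T` (containing all vertices) is an oriented spanning tree
with root `r`: it has no directed cycles, the root has outdegree `0`, and every other vertex has
outdegree `1`. -/
structure IsOrientedSpanningTree (G : DirectedMultigraph V E) (r : V) (T : Set E) : Prop where
  no_directed_cycle : ∀ v, ¬ Relation.TransGen (G.Step T) v v
  outdegree_root : ∀ e ∈ T, G.source e ≠ r
  outdegree_other : ∀ v, v ≠ r → ∃! e, e ∈ T ∧ G.source e = v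

/-- The number `κ(G, r)` of oriented spanning trees of `G` with root `r`. -/
noncomputable def numOrientedSpanningTrees (G : DirectedMultigraph V E) (r : V) : ℕ :=
  {T : Set E | G.IsOrientedSpanningTree r T}.ncard

end DirectedMultigraph

/-- The generalized de Bruijn graph `DB(k, n)`: vertices `0, …, n-1` and, for every vertex `m` and
every `i = 0, …, k-1`, an edge `(m, i)` from `m` to `k * m + i` modulo `n`. -/
def generalizedDeBruijnGraph (k n : ℕ) : DirectedMultigraph (Fin n) (Fin n × Fin k) where
  source e := e.1
  target e := ⟨(k * (e.1 : ℕ) + (e.2 : ℕ)) % n, Nat.mod_lt _ e.1.pos⟩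

/-! Number the edge with index `i` leaving `m` as `x = k * m + i`. It runs from `x / k` to `x % n`;
label it `x / n`, so that an edge is determined by its label and its target. Let a closed Eulerian
trail spell a word through these labels. Then the rotation starting at edge `x` has rank `x` among
all rotations: a smaller label means a smaller edge, and for equal labels the order passes to the
targets and from there to the next edges (`IsTour.window_lt`). The rows of the `m`-th block of `k`
ranks are preceded by the labels of the `k` edges entering `m`, which are distinct, so the BWT is an
alphabet-permutation power. Conversely, the ranks of the rotations of a generalized de Bruijn word
form such a trail (`exists_tour_of_rows`).

Rotating the word rotates the trail, so necklaces correspond to Eulerian trails with a fixed first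
edge (`image_eulerTrails`, `injOn_trailWord`). Their number is given by the BEST theorem
(`card_eulerian`). It is proved for trails with any balanced edge set (`card_trails_eq`), by
induction on deleting the first edge; trees are required to leave only those vertices that still
have outgoing edges, so exhausted vertices do no harm. -/

/-! ### The BEST theorem -/

namespace DirectedMultigraph

variable {V E : Type*}

/-- The list of edges is a walk from `v` to `r`. -/
def IsWalk (G : DirectedMultigraph V E) (r : V) : V → List E → Prop
  | v, [] => v = r
  | v, e :: l => G.source e = v ∧ G.IsWalk r (G.target e) l

/-- The oriented trees with root `r` that use edges from `U` and leave every vertex other than `r`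
that has an outgoing edge in `U`. -/
structure IsTreeIn (G : DirectedMultigraph V E) (r : V) (U T : Finset E) : Prop where
  subset : T ⊆ U
  acyclic : ∀ v, ¬ Relation.TransGen (G.Step (T : Set E)) v v
  root : ∀ e ∈ T, G.source e ≠ r
  other : ∀ e ∈ U, G.source e ≠ r → ∃! f, f ∈ T ∧ G.source f = G.source e

set_option linter.unusedSectionVars false

section Finite

variable [DecidableEq V] [DecidableEq E]

/-- The edges in `U` with source `v`. -/
def outEdges (G : DirectedMultigraph V E) (U : Finset E) (v : V) : Finset E :=
  U.filter fun e => G.source e = v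

/-- The edges in `U` with target `v`. -/
def inEdges (G : DirectedMultigraph V E) (U : Finset E) (v : V) : Finset E :=
  U.filter fun e => G.target e = v

/-- The degree condition satisfied by the edge set of a trail from `v` to `r`. -/
def IsBalanced (G : DirectedMultigraph V E) (r v : V) (U : Finset E) : Prop :=
  ∀ w, (G.outEdges U w).card + (if w = r then 1 else 0) =
    (G.inEdges U w).card + (if w = v then 1 else 0)

open Classical in
/-- The trails from `v` to `r` with edge set `U`. -/
noncomputable def trails (G : DirectedMultigraph V E) (r v : V) (U : Finset E) :
    Finset (List E) :=
  U.val.lists.toFinset.filter (G.IsWalk r v)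

open Classical in
/-- The trees in `U` with root `r`. -/
noncomputable def trees (G : DirectedMultigraph V E) (r : V) (U : Finset E) :
    Finset (Finset E) :=
  U.powerset.filter (G.IsTreeIn r U)

variable {G : DirectedMultigraph V E} {r v w : V} {U T : Finset E} {e : E} {l : List E}

@[simp]
theorem mem_outEdges : e ∈ G.outEdges U v ↔ e ∈ U ∧ G.source e = v := Finset.mem_filter

@[simp]
theorem mem_inEdges : e ∈ G.inEdges U v ↔ e ∈ U ∧ G.target e = v := Finset.mem_filter

@[simp]
theorem mem_trees : T ∈ G.trees r U ↔ G.IsTreeIn r U T := by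
  simp only [trees, Finset.mem_filter, Finset.mem_powerset, and_iff_right_iff_imp]
  exact IsTreeIn.subset

@[simp]
theorem mem_trails : l ∈ G.trails r v U ↔ U.val = l ∧ G.IsWalk r v l := by
  simp [trails]

theorem outEdges_erase_self : G.outEdges (U.erase e) (G.source e) =
    (G.outEdges U (G.source e)).erase e := by
  ext f; simp only [mem_outEdges, Finset.mem_erase]; tauto

theorem outEdges_erase_of_ne (h : G.source e ≠ w) :
    G.outEdges (U.erase e) w = G.outEdges U w := by
  ext f; simp only [mem_outEdges, Finset.mem_erase]
  constructor
  · tauto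
  · rintro ⟨h1, h2⟩
    refine ⟨⟨?_, h1⟩, h2⟩
    rintro rfl; exact h h2

theorem card_outEdges_erase (he : e ∈ U) (w : V) : (G.outEdges (U.erase e) w).card +
    (if w = G.source e then 1 else 0) = (G.outEdges U w).card := by
  split_ifs with h
  · subst h
    rw [outEdges_erase_self, Finset.card_erase_add_one (by simp [he])]
  · rw [outEdges_erase_of_ne (Ne.symm h), add_zero]

theorem card_inEdges_erase (he : e ∈ U) (w : V) : (G.inEdges (U.erase e) w).card +
    (if w = G.target e then 1 else 0) = (G.inEdges U w).card := by
  have := card_outEdges_erase (G := ⟨G.target, G.source⟩) he w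
  exact this

theorem IsBalanced.erase (hU : G.IsBalanced r v U) (he : e ∈ U) (hv : G.source e = v) :
    G.IsBalanced r (G.target e) (U.erase e) := by
  intro w
  have h1 := card_outEdges_erase (G := G) he w
  have h2 := card_inEdges_erase (G := G) he w
  have h3 := hU w
  rw [hv] at h1
  omega

/-- A trail is sorted by its first edge; nonemptiness of `U` excludes the empty trail. -/
theorem card_trails (hU : U.Nonempty) : (G.trails r v U).card =
    ∑ e ∈ G.outEdges U v, (G.trails r (G.target e) (U.erase e)).card := by
  rw [← Finset.card_sigma]
  symm
  refine Finset.card_bij (fun p _ => p.1 :: p.2) ?_ ?_ ?_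
  · rintro ⟨e, l⟩ h
    simp only [Finset.mem_sigma, mem_outEdges, mem_trails] at h ⊢
    refine ⟨?_, h.1.2, h.2.2⟩
    rw [← Multiset.cons_coe, ← h.2.1, Finset.erase_val, Multiset.cons_erase h.1.1]
  · rintro ⟨e, l⟩ h ⟨e', l'⟩ h' heq
    simp_all
  · intro l hl
    rw [mem_trails] at hl
    cases l with
    | nil =>
      obtain ⟨x, hx⟩ := hU
      rw [← Finset.mem_val, hl.1] at hx
      simp at hx
    | cons e l =>
      obtain ⟨h1, h2, h3⟩ := hl
      have he : e ∈ U := by rw [← Finset.mem_val, h1]; simp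
      refine ⟨⟨e, l⟩, ?_, rfl⟩
      simp only [Finset.mem_sigma, mem_outEdges, mem_trails]
      refine ⟨⟨he, h2⟩, ?_, h3⟩
      rw [Finset.erase_val, h1, ← Multiset.cons_coe, Multiset.erase_cons_head]

/-- A tree that avoids an edge leaving the root is a tree without that edge. -/
theorem trees_erase_root (he : G.source e = r) : G.trees r (U.erase e) = G.trees r U := by
  ext T
  rw [mem_trees, mem_trees]
  constructor
  · intro h
    refine ⟨h.subset.trans (Finset.erase_subset _ _), h.acyclic, h.root, fun f hf hfr => ?_⟩
    exact h.other f (Finset.mem_erase.2 ⟨fun h' => hfr (h' ▸ he), hf⟩) hfr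
  · intro h
    refine ⟨fun f hf => Finset.mem_erase.2 ⟨fun h' => h.root f hf (h' ▸ he), h.subset hf⟩,
      h.acyclic, h.root, fun f hf hfr => h.other f (Finset.mem_of_mem_erase hf) hfr⟩

/-- The second edge `f` keeps the source of `e` among the vertices a tree has to leave after `e` is
deleted. -/
theorem isTreeIn_erase_iff (h : ∃ f ∈ U, f ≠ e ∧ G.source f = G.source e) :
    G.IsTreeIn r (U.erase e) T ↔ G.IsTreeIn r U T ∧ e ∉ T := by
  constructor
  · intro hT
    refine ⟨⟨hT.subset.trans (Finset.erase_subset _ _), hT.acyclic, hT.root, fun f hf hfr => ?_⟩,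
      fun heT => by simpa using hT.subset heT⟩
    by_cases hfe : f = e
    · obtain ⟨g, hg, hge, hgs⟩ := h
      subst hfe
      rw [← hgs]
      exact hT.other g (Finset.mem_erase.2 ⟨hge, hg⟩) (hgs ▸ hfr)
    · exact hT.other f (Finset.mem_erase.2 ⟨hfe, hf⟩) hfr
  · rintro ⟨hT, heT⟩
    exact ⟨fun f hf => Finset.mem_erase.2 ⟨fun h' => heT (h' ▸ hf), hT.subset hf⟩,
      hT.acyclic, hT.root, fun f hf hfr => hT.other f (Finset.mem_of_mem_erase hf) hfr⟩

/-- Double counting: a tree uses exactly one of the `d` edges leaving `v`, so it survives the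
deletion of the other `d - 1`. -/
theorem sum_card_trees_erase (hv : v ≠ r) (hd : 1 < (G.outEdges U v).card) :
    ∑ e ∈ G.outEdges U v, (G.trees r (U.erase e)).card =
      ((G.outEdges U v).card - 1) * (G.trees r U).card := by
  classical
  have h1 : ∀ e ∈ G.outEdges U v,
      (G.trees r (U.erase e)).card = ((G.trees r U).filter (e ∉ ·)).card := by
    intro e he
    congr 1
    ext T
    rw [mem_trees, Finset.mem_filter, mem_trees, isTreeIn_erase_iff]
    obtain ⟨f, hf, hfe⟩ := Finset.exists_mem_ne hd e
    rw [mem_outEdges] at he hf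
    exact ⟨f, hf.1, hfe, hf.2.trans he.2.symm⟩
  rw [Finset.sum_congr rfl h1]
  simp only [Finset.card_filter]
  rw [Finset.sum_comm, mul_comm, ← smul_eq_mul, ← Finset.sum_const]
  refine Finset.sum_congr rfl fun T hT => ?_
  rw [mem_trees] at hT
  rw [← Finset.card_filter]
  obtain ⟨e, he⟩ := Finset.card_pos.1 (zero_lt_one.trans hd)
  rw [mem_outEdges] at he
  obtain ⟨f, ⟨hf, hfs⟩, huniq⟩ := hT.other e he.1 (he.2 ▸ hv)
  rw [he.2] at hfs huniq
  have : (G.outEdges U v).filter (· ∉ T) = (G.outEdges U v).erase f := by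
    ext g
    simp only [Finset.mem_filter, mem_outEdges, Finset.mem_erase]
    constructor
    · rintro ⟨h, hg⟩
      exact ⟨fun h' => hg (h' ▸ hf), h⟩
    · rintro ⟨h, hg⟩
      exact ⟨hg, fun h' => h (huniq g ⟨h', hg.2⟩)⟩
  rw [this, Finset.card_erase_of_mem (by simp [hT.subset hf, hfs])]

/-- No edge enters the source of `e`, so a path starting elsewhere never gets there and cannot use
`e`. -/
theorem transGen_step_insert_of_ne (hin : ∀ f ∈ T, G.target f ≠ G.source e)
    (hloop : G.target e ≠ G.source e) {a b : V} (ha : a ≠ G.source e)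
    (h : Relation.TransGen (G.Step (insert e T : Finset E)) a b) :
    Relation.TransGen (G.Step (T : Set E)) a b ∧ b ≠ G.source e := by
  have key : ∀ {a b}, a ≠ G.source e → G.Step (insert e T : Finset E) a b →
      G.Step (T : Set E) a b ∧ b ≠ G.source e := by
    rintro a b ha ⟨f, hf, rfl, rfl⟩
    rw [Finset.mem_coe, Finset.mem_insert] at hf
    rcases hf with rfl | hf
    · exact absurd rfl ha
    · exact ⟨⟨f, hf, rfl, rfl⟩, hin f hf⟩
  induction h with
  | single h => exact ⟨.single (key ha h).1, (key ha h).2⟩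
  | tail _ h ih => exact ⟨ih.1.tail (key ih.2 h).1, (key ih.2 h).2⟩

/-- As the only edge leaving its source, `e` lies in every tree; as nothing enters that source,
adding `e` closes no cycle. -/
theorem card_trees_erase_of_unique (he : e ∈ U) (hr : G.source e ≠ r)
    (hout : ∀ f ∈ U, G.source f = G.source e → f = e)
    (hin : ∀ f ∈ U, G.target f ≠ G.source e) :
    (G.trees r (U.erase e)).card = (G.trees r U).card := by
  refine Finset.card_bij (fun T _ => insert e T) ?_ ?_ ?_
  · intro T hT
    rw [mem_trees] at hT ⊢
    have hTU : T ⊆ U := hT.subset.trans (Finset.erase_subset _ _)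
    refine ⟨Finset.insert_subset he hTU, ?_, ?_, ?_⟩
    · have hmain : ∀ a, a ≠ G.source e →
          ¬ Relation.TransGen (G.Step (insert e T : Finset E)) a a := fun a ha h =>
        hT.acyclic a (transGen_step_insert_of_ne (fun f hf => hin f (hTU hf)) (hin e he) ha h).1
      have hend : ∀ a b, Relation.TransGen (G.Step (insert e T : Finset E)) a b →
          b ≠ G.source e := by
        intro a b h
        obtain ⟨c, -, f, hf, -, rfl⟩ := Relation.TransGen.tail'_iff.1 h
        rw [Finset.mem_coe, Finset.mem_insert] at hf
        rcases hf with rfl | hf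
        · exact hin _ he
        · exact hin f (hTU hf)
      intro a h
      exact hmain a (hend a a h) h
    · intro f hf
      rcases Finset.mem_insert.1 hf with rfl | hf
      · exact hr
      · exact hT.root f hf
    · intro f hf hfr
      by_cases hfe : f = e
      · subst hfe
        exact ⟨f, ⟨Finset.mem_insert_self _ _, rfl⟩,
          fun g hg => hout g (Finset.insert_subset he hTU hg.1) hg.2⟩
      · obtain ⟨g, hg, huniq⟩ := hT.other f (Finset.mem_erase.2 ⟨hfe, hf⟩) hfr
        refine ⟨g, ⟨Finset.mem_insert_of_mem hg.1, hg.2⟩, fun g' hg' => ?_⟩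
        rcases Finset.mem_insert.1 hg'.1 with rfl | h
        · exact absurd (hout f hf hg'.2.symm) hfe
        · exact huniq g' ⟨h, hg'.2⟩
  · intro T hT T' hT' h
    rw [mem_trees] at hT hT'
    have h1 : e ∉ T := fun h => by simpa using hT.subset h
    have h2 : e ∉ T' := fun h => by simpa using hT'.subset h
    rw [← Finset.erase_insert h1, h, Finset.erase_insert h2]
  · intro T hT
    rw [mem_trees] at hT
    have heT : e ∈ T := by
      obtain ⟨f, ⟨hf, hfs⟩, -⟩ := hT.other e he hr
      exact hout f (hT.subset hf) hfs ▸ hf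
    refine ⟨T.erase e, ?_, Finset.insert_erase heT⟩
    rw [mem_trees]
    refine ⟨Finset.erase_subset_erase _ hT.subset, fun a h => hT.acyclic a (Relation.TransGen.mono ?_ _ _ h),
      fun f hf => hT.root f (Finset.mem_of_mem_erase hf), fun f hf hfr => ?_⟩
    · rintro a b ⟨f, hf, h⟩
      exact ⟨f, Finset.mem_of_mem_erase hf, h⟩
    · rw [Finset.mem_erase] at hf
      obtain ⟨g, ⟨hg, hgs⟩, huniq⟩ := hT.other f hf.2 hfr
      refine ⟨g, ⟨Finset.mem_erase.2 ⟨?_, hg⟩, hgs⟩,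
        fun g' hg' => huniq g' ⟨Finset.mem_of_mem_erase hg'.1, hg'.2⟩⟩
      rintro rfl
      exact hf.1 (hout f hf.2 hgs.symm)

/-- The tree edge at a non-root vertex enters a vertex which, by balance, again has an outgoing edge
in `U`. Since `r` has none, one could follow the tree forever, against acyclicity and finiteness. -/
theorem trees_eq_empty [Finite V] (hU : G.IsBalanced r r U) (hne : U.Nonempty)
    (hd : G.outEdges U r = ∅) : G.trees r U = ∅ := by
  rw [Finset.eq_empty_iff_forall_notMem]
  intro T hT
  rw [mem_trees] at hT
  have hout : ∀ e ∈ U, G.source e ≠ r := fun e he h => by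
    have : e ∈ G.outEdges U r := by simp [he, h]
    simp [hd] at this
  let R : V → V → Prop := fun a b => Relation.TransGen (G.Step (T : Set E)) b a
  have : IsTrans V R := ⟨fun a b c h1 h2 => Relation.TransGen.trans h2 h1⟩
  have : Std.Irrefl R := ⟨hT.acyclic⟩
  have hwf : WellFounded R := Finite.wellFounded_of_trans_of_irrefl R
  obtain ⟨e₀, he₀⟩ := hne
  obtain ⟨m, ⟨e, he, rfl⟩, hmin⟩ := hwf.has_min {v | ∃ e ∈ U, G.source e = v} ⟨_, e₀, he₀, rfl⟩
  obtain ⟨f, ⟨hf, hfs⟩, -⟩ := hT.other e he (hout e he)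
  have hin : 0 < (G.inEdges U (G.target f)).card :=
    Finset.card_pos.2 ⟨f, by simp [hT.subset hf]⟩
  have hbal := Nat.add_right_cancel (hU (G.target f))
  obtain ⟨g, hg⟩ := Finset.card_pos.1 (hbal ▸ hin)
  rw [mem_outEdges] at hg
  exact hmin (G.target f) ⟨g, hg⟩ (.single ⟨f, hf, hfs, rfl⟩)

/-- The factor contributed by a vertex of outdegree `d` to the number of trails ending in `r`. -/
def vertexFactor (r w : V) (d : ℕ) : ℕ := if w = r then d.factorial else (d - 1).factorial

/-- This is the inductive step at the starting vertex, with three cases: the root, whose edges lie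
in no tree; another vertex with several outgoing edges; another vertex about to be left for the last
time. -/
theorem sum_vertexFactor_mul_card_trees (hU : G.IsBalanced r v U)
    (hd : 0 < (G.outEdges U v).card) :
    ∑ e ∈ G.outEdges U v, vertexFactor r v ((G.outEdges U v).card - 1) *
      (G.trees r (U.erase e)).card =
    vertexFactor r v (G.outEdges U v).card * (G.trees r U).card := by
  by_cases hv : v = r
  · subst hv
    rw [Finset.sum_congr rfl fun e he => by rw [trees_erase_root (mem_outEdges.1 he).2],
      Finset.sum_const, smul_eq_mul, ← mul_assoc]
    simp only [vertexFactor, if_true, Nat.mul_factorial_pred hd.ne']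
  · simp only [vertexFactor, if_neg hv]
    rcases Nat.lt_or_ge 1 (G.outEdges U v).card with h1 | h1
    · rw [← Finset.mul_sum, sum_card_trees_erase hv h1, ← mul_assoc,
        mul_comm _ ((G.outEdges U v).card - 1), Nat.mul_factorial_pred (by omega)]
    · obtain ⟨e, he⟩ := Finset.card_eq_one.1 (le_antisymm h1 hd)
      have hmem : e ∈ G.outEdges U v := by simp [he]
      rw [mem_outEdges] at hmem
      -- Outdegree one at the start `v ≠ r` forces indegree zero.
      have hin : G.inEdges U v = ∅ := by
        have := hU v
        rw [he, if_neg hv, if_pos rfl, Finset.card_singleton] at this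
        exact Finset.card_eq_zero.1 (by omega)
      rw [he, Finset.sum_singleton, card_trees_erase_of_unique hmem.1 (hmem.2.symm ▸ hv)]
      · simp
      · intro f hf hfs
        have : f ∈ G.outEdges U v := by simp [hf, hfs, hmem.2]
        simpa [he] using this
      · intro f hf hft
        have : f ∈ G.inEdges U v := by simp [hf, hft, hmem.2]
        simp [hin] at this

theorem trails_empty : G.trails r r ∅ = {[]} := by
  ext l
  rw [mem_trails, Finset.mem_singleton, Finset.empty_val, eq_comm, Multiset.coe_eq_zero]
  constructor
  · exact And.left
  · rintro rfl; exact ⟨rfl, rfl⟩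

theorem trees_empty : G.trees r ∅ = {∅} := by
  ext T
  rw [mem_trees, Finset.mem_singleton]
  constructor
  · exact fun h => Finset.subset_empty.1 h.subset
  · rintro rfl
    refine ⟨subset_rfl, fun v h => ?_, by simp, by simp⟩
    obtain ⟨c, -, f, hf, -⟩ := Relation.TransGen.tail'_iff.1 h
    simp at hf

/-- The BEST theorem for trails with edge set `U`. -/
theorem card_trails_eq [Fintype V] (hU : G.IsBalanced r v U) : (G.trails r v U).card =
    (∏ w, vertexFactor r w (G.outEdges U w).card) * (G.trees r U).card := by
  induction hn : U.card generalizing U v with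
  | zero =>
    rw [Finset.card_eq_zero] at hn
    subst hn
    have hv : v = r := by
      by_contra h
      have := hU v
      simp [outEdges, inEdges, h] at this
    subst hv
    simp [trails_empty, trees_empty, outEdges, vertexFactor]
  | succ n ih =>
    have hne : U.Nonempty := Finset.card_pos.1 (by omega)
    rw [card_trails hne]
    -- A trail stuck at its start with edges left over: balance forces `v = r`, and both sides
    -- vanish.
    rcases Nat.eq_zero_or_pos (G.outEdges U v).card with hd | hd
    · have hv : v = r := by
        by_contra h
        have := hU v
        rw [if_neg h, if_pos rfl] at this
        omega
      subst hv
      rw [Finset.card_eq_zero] at hd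
      rw [trees_eq_empty hU hne hd, hd]
      simp
    · rw [← Finset.mul_prod_erase _ _ (Finset.mem_univ v), mul_right_comm,
        ← sum_vertexFactor_mul_card_trees hU hd, Finset.sum_mul]
      refine Finset.sum_congr rfl fun e he => ?_
      rw [mem_outEdges] at he
      rw [ih (hU.erase he.1 he.2) (by rw [Finset.card_erase_of_mem he.1]; omega),
        ← Finset.mul_prod_erase _ _ (Finset.mem_univ v), mul_right_comm]
      congr 1
      · congr 2
        obtain ⟨he, rfl⟩ := he
        rw [outEdges_erase_self, Finset.card_erase_of_mem (by simp [he])]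
      · refine Finset.prod_congr rfl fun w hw => ?_
        rw [outEdges_erase_of_ne]
        rw [he.2]
        exact (Finset.ne_of_mem_erase hw).symm

/-- When every vertex has an outgoing edge, the relaxed trees are the spanning trees. -/
theorem numOrientedSpanningTrees_eq [Fintype E] (hout : ∀ w, ∃ e, G.source e = w) :
    G.numOrientedSpanningTrees r = (G.trees r Finset.univ).card := by
  classical
  rw [numOrientedSpanningTrees, ← Set.ncard_coe_finset,
    ← Set.ncard_image_of_injective _ Finset.coe_injective]
  congr 1
  ext T
  simp only [Set.mem_ofPred_eq, Set.mem_image, Finset.mem_coe, mem_trees]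
  constructor
  · intro hT
    refine ⟨T.toFinset, ⟨Finset.subset_univ _, ?_, ?_, ?_⟩, Set.coe_toFinset T⟩
    · rw [Set.coe_toFinset]
      exact hT.no_directed_cycle
    · exact fun e he => hT.outdegree_root e (Set.mem_toFinset.1 he)
    · intro e _ he
      simpa only [Set.mem_toFinset] using hT.outdegree_other _ he
  · rintro ⟨T, hT, rfl⟩
    refine ⟨hT.acyclic, hT.root, fun w hw => ?_⟩
    obtain ⟨e, he⟩ := hout w
    have := hT.other e (Finset.mem_univ e) (he ▸ hw)
    rwa [he] at this

/-- The number of closed trails that start with a given edge `e` leaving `r` and use all edges. -/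
theorem card_eulerian [Fintype V] [Fintype E] {k : ℕ} (hk : 0 < k)
    (hout : ∀ w, (G.outEdges Finset.univ w).card = k)
    (hin : ∀ w, (G.inEdges Finset.univ w).card = k) (e : E) :
    (G.trails (G.source e) (G.target e) (Finset.univ.erase e)).card =
      (k - 1).factorial ^ Fintype.card V * G.numOrientedSpanningTrees (G.source e) := by
  have hb : G.IsBalanced (G.source e) (G.source e) Finset.univ := fun w => by rw [hout, hin]
  have hsurj : ∀ w, ∃ e, G.source e = w := fun w => by
    obtain ⟨e, he⟩ := Finset.card_pos.1 (hk.trans_eq (hout w).symm)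
    exact ⟨e, (mem_outEdges.1 he).2⟩
  rw [card_trails_eq (hb.erase (Finset.mem_univ e) rfl), trees_erase_root rfl,
    numOrientedSpanningTrees_eq hsurj]
  congr 1
  rw [← Finset.card_univ, ← Finset.prod_const]
  refine Finset.prod_congr rfl fun w _ => ?_
  -- The root has lost `e` and contributes the factorial of its outdegree `k - 1`; any other vertex
  -- keeps outdegree `k` and contributes `(k - 1)!` as well.
  have := card_outEdges_erase (G := G) (Finset.mem_univ e) w
  rw [hout] at this
  unfold vertexFactor
  split_ifs at this ⊢ with h
  · congr 1; omega
  · congr 2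

end Finite

end DirectedMultigraph

/-! ### Counting lemmas and alphabet-permutation powers -/

theorem Fin.eq_of_strictMono {N : ℕ} {f : Fin N → Fin N} (hf : StrictMono f) (p : Fin N) :
    f p = p :=
  le_antisymm (hf.dual.le_apply (x := OrderDual.toDual p)) hf.le_apply

/-- Pigeonhole on both sides of `p`: the `p + 1` positions up to `p` take at most `F p + 1` values,
the `k * n - p` positions from `p` on at most `k - F p`, each at most `n` times. -/
theorem Fin.val_eq_div_of_monotone {k n : ℕ} {F : Fin (k * n) → Fin k} (hF : Monotone F)
    (hc : ∀ a, (Finset.univ.filter fun p => F p = a).card ≤ n) (p : Fin (k * n)) :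
    (F p : ℕ) = p / n := by
  have key : ∀ (s : Finset (Fin (k * n))) (t : Finset (Fin k)), (∀ q ∈ s, F q ∈ t) →
      s.card ≤ n * t.card := fun s t h =>
    Finset.card_le_mul_card_image_of_maps_to h n fun b _ =>
      (Finset.card_le_card (Finset.filter_subset_filter _ (Finset.subset_univ s))).trans (hc b)
  have h1 := key (Finset.Iic p) (Finset.Iic (F p)) fun q hq =>
    Finset.mem_Iic.2 (hF (Finset.mem_Iic.1 hq))
  have h2 := key (Finset.Ici p) (Finset.Ici (F p)) fun q hq =>
    Finset.mem_Ici.2 (hF (Finset.mem_Ici.1 hq))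
  rw [Fin.card_Iic, Fin.card_Iic] at h1
  rw [Fin.card_Ici, Fin.card_Ici, Nat.mul_sub, mul_comm n k] at h2
  have h3 : n * (F p : ℕ) ≤ k * n := by
    rw [mul_comm]; exact Nat.mul_le_mul_right _ (F p).2.le
  have h4 := p.2
  refine (Nat.div_eq_of_lt_le ?_ ?_).symm
  · rw [mul_comm _ n]; omega
  · exact h1.trans_eq (mul_comm _ _)

theorem Finset.sum_range_add_of_periodic {f : ℕ → ℕ} {N : ℕ} (hf : Function.Periodic f N) (i : ℕ) :
    ∑ t ∈ Finset.range N, f (i + t) = ∑ t ∈ Finset.range N, f t := by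
  induction i with
  | zero => simp
  | succ i ih =>
    rw [← ih]
    have h1 := Finset.sum_range_succ (fun t => f (i + t)) N
    have h2 := Finset.sum_range_succ' (fun t => f (i + t)) N
    rw [hf i] at h1
    simp only [add_zero] at h2
    simp only [add_right_comm i 1, add_assoc] at h1 h2 ⊢
    omega

theorem isAlphabetPermutation_iff {k : ℕ} {w : List (Fin k)} :
    IsAlphabetPermutation w ↔ w.length = k ∧ w.Nodup := by
  constructor
  · intro h
    have hn : w.Nodup := List.nodup_iff_count_le_one.2 fun a => (h a).le
    refine ⟨?_, hn⟩
    rw [← List.toFinset_card_of_nodup hn, Finset.eq_univ_of_forall (s := w.toFinset) fun a => ?_,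
      Finset.card_univ, Fintype.card_fin]
    rw [List.mem_toFinset, ← List.count_pos_iff, h a]
    exact Nat.one_pos
  · rintro ⟨h, hn⟩ a
    refine List.count_eq_one_of_mem hn ?_
    have : w.toFinset = Finset.univ := by
      rw [← Finset.card_eq_iff_eq_univ, List.toFinset_card_of_nodup hn, h, Fintype.card_fin]
    rw [← List.mem_toFinset, this]
    exact Finset.mem_univ a

/-- All factors have length `k`, so the factorization can only be the cut into consecutive blocks,
and a block of length `k` is an alphabet-permutation iff it has no repetition. -/
theorem isAlphabetPermutationPower_ofFn_iff {k n : ℕ} (hn : 0 < n) (u : Fin (k * n) → Fin k) :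
    IsAlphabetPermutationPower (List.ofFn u) ↔
      ∀ y y' : Fin (k * n), (y : ℕ) / k = y' / k → u y = u y' → y = y' := by
  have hblock : ∀ b : Fin n, ∀ i : Fin k, k * (b : ℕ) + i < k * n := fun b i =>
    calc k * (b : ℕ) + i < k * (b + 1) := by rw [mul_add, mul_one]; omega
      _ ≤ k * n := Nat.mul_le_mul_left k b.2
  have hflat : List.ofFn u = (List.ofFn fun b : Fin n => List.ofFn fun i : Fin k =>
    u ⟨k * b + i, hblock b i⟩).flatten := List.ofFn_mul' u
  constructor
  · rintro ⟨L, -, hL, hLu⟩ y y' hyy huy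
    have hk : 0 < k := Nat.pos_of_mul_pos_right y.pos
    have hlen : L.map List.length = List.replicate L.length k :=
      List.map_eq_replicate_iff.2 fun w hw => (isAlphabetPermutation_iff.1 (hL w hw)).1
    have hLn : L.length = n := by
      have := congrArg List.length hLu
      rw [List.length_flatten, hlen, List.sum_replicate, List.length_ofFn, smul_eq_mul,
        mul_comm] at this
      exact Nat.eq_of_mul_eq_mul_left hk this
    have hLeq : L = List.ofFn fun b : Fin n => List.ofFn fun i : Fin k =>
        u ⟨k * b + i, hblock b i⟩ := by
      refine List.eq_iff_flatten_eq.2 ⟨hLu.trans hflat, ?_⟩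
      rw [hlen, hLn, eq_comm, List.map_eq_replicate_iff.2, List.length_ofFn]
      intro w hw
      obtain ⟨b, rfl⟩ := List.mem_ofFn.1 hw
      exact List.length_ofFn
    have hb : (y : ℕ) / k < n := Nat.div_lt_of_lt_mul y.2
    have hinj := (isAlphabetPermutation_iff.1 (hL _ (hLeq ▸ List.mem_ofFn.2
      ⟨⟨(y : ℕ) / k, hb⟩, rfl⟩))).2
    rw [List.nodup_ofFn] at hinj
    have hy : ∀ z : Fin (k * n), (z : ℕ) / k = y / k →
        (⟨k * ((y : ℕ) / k) + z % k, hblock ⟨_, hb⟩ ⟨_, Nat.mod_lt _ hk⟩⟩ : Fin (k * n)) = z :=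
      fun z hz => Fin.ext (by
        show k * ((y : ℕ) / k) + z % k = z
        rw [← hz]; exact Nat.div_add_mod _ _)
    have := @hinj ⟨y % k, Nat.mod_lt _ hk⟩ ⟨y' % k, Nat.mod_lt _ hk⟩
      (by simp only; rw [hy y rfl, hy y' hyy.symm, huy])
    rw [← hy y rfl, ← hy y' hyy.symm]
    exact Fin.ext (congrArg (k * ((y : ℕ) / k) + ·) (Fin.mk.inj this))
  · intro h
    refine ⟨_, ?_, ?_, hflat.symm⟩
    · exact List.ne_nil_of_length_pos (by rwa [List.length_ofFn])
    · intro w hw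
      obtain ⟨b, rfl⟩ := List.mem_ofFn.1 hw
      refine isAlphabetPermutation_iff.2 ⟨List.length_ofFn, List.nodup_ofFn.2 fun i j hij => ?_⟩
      have hk : 0 < k := i.pos
      have := congrArg Fin.val (h _ _ (by
        simp only
        rw [Nat.mul_add_div hk, Nat.mul_add_div hk, Nat.div_eq_of_lt i.2, Nat.div_eq_of_lt j.2]) hij)
      exact Fin.ext (Nat.add_left_cancel this)

/-! ### Rotations as windows of a periodic sequence -/

/-- The word of length `N` that starts at position `i` of the sequence `f`. -/
def window {α : Type*} (f : ℕ → α) (N i : ℕ) : List α := List.ofFn fun t : Fin N => f (i + t)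

section Window

theorem window_map {α β : Type*} (f : ℕ → α) (g : α → β) (N i : ℕ) :
    (window f N i).map g = window (g ∘ f) N i := List.map_ofFn

theorem window_eq_iff {α : Type*} {N i j : ℕ} {f g : ℕ → α} (hf : Function.Periodic f N)
    (hg : Function.Periodic g N) (hN : 0 < N) :
    window f N i = window g N j ↔ ∀ t, f (i + t) = g (j + t) := by
  constructor
  · intro h t
    have := congrFun (List.ofFn_injective h) ⟨t % N, Nat.mod_lt _ hN⟩
    simp only at this
    rw [← hf.map_mod_nat (i + t), ← hg.map_mod_nat (j + t), ← Nat.add_mod_mod i,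
      ← Nat.add_mod_mod j, hf.map_mod_nat, hg.map_mod_nat, this]
  · intro h
    exact congrArg List.ofFn (funext fun t => h t)

theorem window_rotate {α : Type*} {N : ℕ} {f : ℕ → α} (hf : Function.Periodic f N) (s : ℕ) :
    (window f N 0).rotate s = window f N s := by
  refine List.ext_getElem (by simp [window]) fun t h3 h4 => ?_
  rw [List.getElem_rotate]
  simp only [window, List.getElem_ofFn, List.length_ofFn, zero_add]
  rw [hf.map_mod_nat, add_comm]

variable {k N : ℕ} {f : ℕ → Fin k} {i j : ℕ}

theorem window_lt_iff : window f N i < window f N j ↔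
    ∃ m < N, (∀ t < m, f (i + t) = f (j + t)) ∧ f (i + m) < f (j + m) := by
  rw [List.lt_iff_exists]
  simp only [window, List.length_ofFn, lt_irrefl, and_false, false_or, List.getElem_ofFn,
    exists_prop]
  constructor
  · rintro ⟨m, h1, -, h⟩; exact ⟨m, h1, h⟩
  · rintro ⟨m, h1, h⟩; exact ⟨m, h1, h1, h⟩

theorem window_mod (hf : Function.Periodic f N) : window f N (i % N) = window f N i := by
  refine congrArg List.ofFn (funext fun t => ?_)
  rw [← hf.map_mod_nat (i + t), ← Nat.mod_add_mod i, hf.map_mod_nat]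

theorem head_le_of_window_le (hf : Function.Periodic f N) (hN : 0 < N)
    (h : window f N i ≤ window f N j) : f i ≤ f j := by
  rcases h.lt_or_eq with h | h
  · obtain ⟨m, -, h1, h2⟩ := window_lt_iff.1 h
    rcases m.eq_zero_or_pos with rfl | hm
    · exact h2.le
    · exact (h1 0 hm).le
  · exact ((window_eq_iff hf hf hN).1 h 0).le

theorem window_succ_lt (h : window f N i < window f N j) (hij : f i = f j) :
    window f N (i + 1) < window f N (j + 1) := by
  obtain ⟨m, hm, h1, h2⟩ := window_lt_iff.1 h
  cases m with
  | zero => exact absurd hij h2.ne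
  | succ m =>
    refine window_lt_iff.2 ⟨m, by omega, fun t ht => ?_, ?_⟩
    · have := h1 (t + 1) (by omega)
      rwa [add_right_comm, add_right_comm j, add_assoc, add_assoc j]
    · rwa [add_right_comm, add_right_comm j, add_assoc, add_assoc j]

/-- Any sorting permutation serves, since tied rows are equal words. The last letter of a row is the
one cyclically preceding its start, hence the offset `N - 1`. -/
theorem bwt_window (hf : Function.Periodic f N) (hN : 0 < N) (g : Equiv.Perm (Fin N))
    (hg : Monotone fun y => window f N (g y)) :
    bwt (window f N 0 : Cycle (Fin k)) = List.ofFn fun y => f (g y + (N - 1)) := by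
  have hperm : (window f N 0).cyclicPermutations = List.ofFn fun i : Fin N => window f N i := by
    have hlen : (window f N 0).length = N := List.length_ofFn
    have hne : window f N 0 ≠ [] := List.ne_nil_of_length_pos (hN.trans_eq hlen.symm)
    refine List.ext_getElem (by simp [List.length_cyclicPermutations_of_ne_nil _ hne, hlen])
      fun i h1 h2 => ?_
    rw [List.getElem_cyclicPermutations, List.getElem_ofFn, window_rotate hf]
  have hmat : bwtMatrix (window f N 0 : Cycle (Fin k)) = List.ofFn fun y => window f N (g y) := by
    refine List.Perm.eq_of_pairwise (le := (· ≤ ·)) (fun a b _ _ => le_antisymm)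
      (Multiset.pairwise_sort _ _) ?_ ?_
    · rw [List.pairwise_ofFn]
      exact fun i j hij => hg hij.le
    · rw [← Multiset.coe_eq_coe, bwtMatrix, Multiset.sort_eq, Cycle.lists_coe, hperm,
        Multiset.coe_eq_coe]
      exact (g.ofFn_comp_perm fun i => window f N i).symm
  rw [bwt, hmat]
  have : ∀ y, (window f N (g y)).getLast? = some (f (g y + (N - 1))) := fun y => by
    rw [List.getLast?_eq_getElem?, window, List.length_ofFn, List.getElem?_ofFn,
      dif_pos (by omega)]
  rw [List.ofFn_eq_map, List.filterMap_map, List.ofFn_eq_map, ← List.filterMap_eq_map]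
  congr 1
  funext y
  exact this y

end Window

/-! ### Eulerian tours and sorted rotations -/

/-- An Eulerian tour of the generalized de Bruijn graph, given as a periodic sequence of edges, with
the edge `(m, i)` encoded as `k * m + i`. -/
structure IsTour (k n : ℕ) (x : ℕ → ℕ) : Prop where
  periodic : Function.Periodic x (k * n)
  lt : ∀ i, x i < k * n
  surj : ∀ y < k * n, ∃ i, x i = y
  step : ∀ i, x (i + 1) / k = x i % n

/-- `f` is the sequence of labels of the tour `x`, the label of the edge `e` being `e / n`. -/
def IsLabel {k : ℕ} (n : ℕ) (x : ℕ → ℕ) (f : ℕ → Fin k) : Prop :=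
  ∀ i, (f i : ℕ) = x i / n

section Tour

variable {k n : ℕ} {x y : ℕ → ℕ} {f : ℕ → Fin k} {i j : ℕ}

theorem IsTour.pos (hx : IsTour k n x) : 0 < k * n := (Nat.zero_le _).trans_lt (hx.lt 0)

theorem IsTour.pos_right (hx : IsTour k n x) : 0 < n := Nat.pos_of_mul_pos_left hx.pos

theorem IsTour.exists_lt (hx : IsTour k n x) {y : ℕ} (hy : y < k * n) : ∃ i < k * n, x i = y := by
  obtain ⟨i, hi⟩ := hx.surj y hy
  exact ⟨i % (k * n), Nat.mod_lt _ hx.pos, by rw [hx.periodic.map_mod_nat, hi]⟩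

theorem IsTour.bijective (hx : IsTour k n x) :
    Function.Bijective fun i : Fin (k * n) => (⟨x i, hx.lt i⟩ : Fin (k * n)) := by
  refine Function.Surjective.bijective_of_finite fun y => ?_
  obtain ⟨i, hi, h⟩ := hx.exists_lt y.2
  exact ⟨⟨i, hi⟩, Fin.ext h⟩

theorem IsTour.modEq (hx : IsTour k n x) (h : x i = x j) : i ≡ j [MOD k * n] := by
  have := hx.bijective.injective (a₁ := ⟨i % (k * n), Nat.mod_lt _ hx.pos⟩)
    (a₂ := ⟨j % (k * n), Nat.mod_lt _ hx.pos⟩) (Fin.ext (by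
      simp only [hx.periodic.map_mod_nat, h]))
  exact congrArg Fin.val this

theorem IsTour.shift (hx : IsTour k n x) (s : ℕ) : IsTour k n fun i => x (i + s) where
  periodic i := by
    show x (i + k * n + s) = x (i + s)
    rw [add_right_comm, hx.periodic]
  lt i := hx.lt _
  surj y hy := by
    obtain ⟨i, hi⟩ := hx.surj y hy
    refine ⟨i + (k * n - s % (k * n)), ?_⟩
    have h1 := Nat.mod_lt s hx.pos
    have h2 := Nat.mod_add_div s (k * n)
    have : i + (k * n - s % (k * n)) + s = i + (1 + s / (k * n)) * (k * n) := by
      rw [add_mul, one_mul, mul_comm (s / _)]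
      omega
    rw [this]
    exact (hx.periodic.nat_mul _ i).trans hi
  step i := by
    show x (i + 1 + s) / k = x (i + s) % n
    rw [add_right_comm, hx.step]

theorem IsLabel.periodic (hx : IsTour k n x) (hf : IsLabel n x f) :
    Function.Periodic f (k * n) := fun i => Fin.ext (by rw [hf, hf, hx.periodic])

/-- With equal quotients by `n` the residues are strictly ordered, and they are the blocks of the
next edges. -/
theorem IsTour.succ_lt (hx : IsTour k n x) (h : x i < x j) (hij : x i / n = x j / n) :
    x (i + 1) < x (j + 1) := by
  by_contra hle
  have h1 := Nat.div_le_div_right (c := k) (not_lt.1 hle)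
  rw [hx.step, hx.step] at h1
  have h2 := Nat.div_add_mod (x i) n
  have h3 := Nat.div_add_mod (x j) n
  rw [hij] at h2
  omega

theorem IsTour.window_lt (hx : IsTour k n x) (hf : IsLabel n x f) (h : x i < x j) :
    window f (k * n) i < window f (k * n) j := by
  rw [window_lt_iff]
  by_contra hcon
  push Not at hcon
  have hle : ∀ {i j}, x i < x j → f i ≤ f j := fun {i j} h => by
    rw [Fin.le_def, hf, hf]
    exact Nat.div_le_div_right h.le
  -- If the windows were not ordered as claimed, the labels would agree for a whole period and the
  -- edges would stay strictly ordered; but both runs sum the same values over a period.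
  have key : ∀ m ≤ k * n, x (i + m) < x (j + m) ∧ ∀ t < m, f (i + t) = f (j + t) := by
    intro m
    induction m with
    | zero => exact fun _ => ⟨h, by simp⟩
    | succ m ih =>
      intro hm
      obtain ⟨h1, h2⟩ := ih (by omega)
      have h3 : f (i + m) = f (j + m) := le_antisymm (hle h1) (hcon m (by omega) h2)
      refine ⟨hx.succ_lt h1 ((hf _).symm.trans ((congrArg Fin.val h3).trans (hf _))), fun t ht => ?_⟩
      rcases Nat.lt_succ_iff_lt_or_eq.1 ht with ht | rfl
      · exact h2 t ht
      · exact h3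
  have h1 := Finset.sum_lt_sum_of_nonempty (s := Finset.range (k * n))
    (Finset.nonempty_range_iff.2 hx.pos.ne') fun t ht => (key t (Finset.mem_range.1 ht).le).1
  rw [Finset.sum_range_add_of_periodic hx.periodic,
    Finset.sum_range_add_of_periodic hx.periodic] at h1
  exact lt_irrefl _ h1

theorem IsTour.window_lt_iff (hx : IsTour k n x) (hf : IsLabel n x f) :
    window f (k * n) i < window f (k * n) j ↔ x i < x j := by
  refine ⟨fun h => ?_, hx.window_lt hf⟩
  rcases lt_trichotomy (x i) (x j) with h' | h' | h'
  · exact h'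
  · rw [← window_mod (hf.periodic hx), ← window_mod (i := j) (hf.periodic hx),
      hx.modEq h'] at h
    exact absurd h (lt_irrefl _)
  · exact absurd h (hx.window_lt hf h').not_gt

/-- A tour is determined by its labels. -/
theorem IsTour.eq_of_label (hx : IsTour k n x) (hy : IsTour k n y) (hf : IsLabel n x f)
    (hf' : IsLabel n y f) : x = y := by
  let g := Equiv.ofBijective _ hx.bijective
  have hg : ∀ p, x (g.symm p) = p := fun p => congrArg Fin.val (g.apply_symm_apply p)
  -- Both tours order positions as the windows of `f` do, so the map from `x`-values to `y`-values
  -- is increasing, hence the identity.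
  have hmono : StrictMono fun p => (⟨y (g.symm p), hy.lt _⟩ : Fin (k * n)) := by
    intro p q hpq
    rw [Fin.lt_def, ← hg p, ← hg q, ← hx.window_lt_iff hf, hy.window_lt_iff hf'] at hpq
    exact hpq
  have key : ∀ i : Fin (k * n), x i = y i := fun i => by
    have := congrArg Fin.val (Fin.eq_of_strictMono hmono (g i))
    simp only [g.symm_apply_apply] at this
    exact this.symm
  funext i
  rw [← hx.periodic.map_mod_nat, ← hy.periodic.map_mod_nat]
  exact key ⟨i % (k * n), Nat.mod_lt _ hx.pos⟩

theorem IsTour.isGeneralizedDeBruijnWord (hx : IsTour k n x) (hf : IsLabel n x f) :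
    IsGeneralizedDeBruijnWord k n (window f (k * n) 0 : Cycle (Fin k)) := by
  have hper := hf.periodic hx
  refine ⟨by simp [window], ?_⟩
  let g := Equiv.ofBijective _ hx.bijective
  have hg : ∀ p, x (g.symm p) = p := fun p => congrArg Fin.val (g.apply_symm_apply p)
  rw [bwt_window hper hx.pos g.symm, isAlphabetPermutationPower_ofFn_iff hx.pos_right]
  · intro p q hpq h
    -- The edge preceding edge `p` enters the source `p / k` of `p`; with its label, this determines
    -- it.
    have hstep : ∀ p : Fin (k * n), x (g.symm p + (k * n - 1)) % n = p / k := fun p => by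
      have := hx.pos
      rw [← hx.step, add_assoc, Nat.sub_add_cancel this, hx.periodic, hg]
    have hdiv := congrArg Fin.val h
    rw [hf, hf] at hdiv
    have hmod := (hstep p).trans (hpq.trans (hstep q).symm)
    have heq : x (g.symm p + (k * n - 1)) = x (g.symm q + (k * n - 1)) := by
      rw [← Nat.div_add_mod (x (g.symm p + (k * n - 1))) n, hdiv, hmod, Nat.div_add_mod]
    have := (Nat.ModEq.add_right_cancel' _ (hx.modEq heq)).eq_of_lt_of_lt (g.symm p).2 (g.symm q).2
    exact g.symm.injective (Fin.ext this)
  · intro p q hpq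
    rcases hpq.lt_or_eq with h | rfl
    · refine (hx.window_lt hf ?_).le
      rw [hg, hg]
      exact h
    · exact le_rfl

/-- The sorted rows of the Burrows–Wheeler matrix of a generalized de Bruijn word yield a tour. -/
theorem exists_tour_of_rows (hk : 1 < k) (hn : 0 < n) (hf : Function.Periodic f (k * n))
    (g : Equiv.Perm (Fin (k * n))) (hg : Monotone fun p => window f (k * n) (g p))
    (hblock : ∀ p q : Fin (k * n), (p : ℕ) / k = q / k →
      f (g p + (k * n - 1)) = f (g q + (k * n - 1)) → p = q) :
    ∃ x, IsTour k n x ∧ IsLabel n x f := by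
  have hN : 0 < k * n := by positivity
  have hN1 : 1 < k * n := hk.trans_le (Nat.le_mul_of_pos_right k hn)
  -- The rank of the rotation starting at `i`.
  let x : ℕ → Fin (k * n) := fun i => g.symm ⟨i % (k * n), Nat.mod_lt _ hN⟩
  have hgx : ∀ i, ((g (x i) : Fin (k * n)) : ℕ) = i % (k * n) := fun i => by
    simp only [x, g.apply_symm_apply]
  have hxg : ∀ p, x (g p) = p := fun p => by
    simp only [x]
    rw [g.symm_apply_eq]
    exact Fin.ext (Nat.mod_eq_of_lt (g p).2)
  have hxper : Function.Periodic x (k * n) := fun i => by simp only [x, Nat.add_mod_right]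
  have hwin : ∀ i, window f (k * n) (g (x i)) = window f (k * n) i := fun i => by
    rw [hgx, window_mod hf]
  have hmono : ∀ {i j}, x i ≤ x j → window f (k * n) i ≤ window f (k * n) j := fun {i j} h => by
    have := hg h
    simp only [hwin] at this
    exact this
  have hpred : ∀ i, f (g (x (i + 1)) + (k * n - 1)) = f i := fun i => by
    rw [hgx, ← hf.map_mod_nat, Nat.mod_add_mod, add_assoc, Nat.add_sub_cancel' hN,
      Nat.add_mod_right, hf.map_mod_nat]
  have hblock' : ∀ {i j}, (x (i + 1) : ℕ) / k = x (j + 1) / k → f i = f j →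
      x (i + 1) = x (j + 1) := fun {i j} h h' => hblock _ _ h (by rw [hpred, hpred, h'])
  have hmod : ∀ {i j}, x i = x j → i ≡ j [MOD k * n] := fun {i j} h => by
    have := congrArg (fun p => (g p : ℕ)) h
    simp only [hgx] at this
    exact this
  -- The rotations are distinct. Otherwise shift two equal ones by `e` so that the first gets rank
  -- `0`; the other has positive rank, so rows `0` and `1` coincide. Since `k > 1` they share a
  -- block, and equal preceding letters contradict `hblock`.
  have hinj : ∀ {i j}, window f (k * n) i = window f (k * n) j → x i = x j := by
    intro i j hij
    by_contra hne
    set p₀ : Fin (k * n) := ⟨0, hN⟩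
    set p₁ : Fin (k * n) := ⟨1, hN1⟩
    obtain ⟨e, he⟩ : ∃ e, e = k * n - i % (k * n) + g p₀ := ⟨_, rfl⟩
    have hi : x (i + e) = p₀ := by
      have h1 := Nat.mod_lt i hN
      have h2 := Nat.mod_add_div i (k * n)
      have : i + e = g p₀ + (1 + i / (k * n)) * (k * n) := by
        rw [he, add_mul, one_mul, mul_comm (i / _)]
        omega
      rw [this]
      exact (hxper.nat_mul _ _).trans (hxg p₀)
    have hj : x (j + e) ≠ p₀ := fun h => hne (by
      have := Nat.ModEq.add_right_cancel' e (hmod (hi.trans h.symm))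
      rw [← hxper.map_mod_nat, this, hxper.map_mod_nat])
    have hije : window f (k * n) (i + e) = window f (k * n) (j + e) := by
      rw [window_eq_iff hf hf hN] at hij ⊢
      exact fun t => by rw [add_assoc, hij, add_assoc]
    have h0 : window f (k * n) (g p₀) = window f (k * n) (i + e) := by rw [← hi, hwin]
    have h1 : window f (k * n) (g p₁) = window f (k * n) (i + e) := by
      refine le_antisymm ((hmono ?_).trans_eq hije.symm) (hmono ?_)
      · rw [hxg, Fin.le_def]
        exact Nat.pos_of_ne_zero fun h => hj (Fin.ext h)
      · rw [hxg, hi]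
        exact Nat.zero_le 1
    have h2 := (window_eq_iff hf hf hN).1 (h0.trans h1.symm) (k * n - 1)
    have h3 := hblock p₀ p₁ (by simp [p₀, p₁, Nat.div_eq_of_lt hk]) h2
    exact absurd (congrArg Fin.val h3) (by simp [p₀, p₁])
  have hlt : ∀ {i j}, window f (k * n) i < window f (k * n) j ↔ x i < x j := by
    intro i j
    constructor
    · intro h
      by_contra h'
      exact absurd h (hmono (not_lt.1 h')).not_gt
    · intro h
      exact (hmono h.le).lt_of_ne fun h' => h.ne (hinj h')
  have hlabel : ∀ i, (f i : ℕ) = x i / n := by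
    intro i
    have hF : Monotone fun p => f (g p) := fun p q hpq =>
      head_le_of_window_le hf hN (hg hpq)
    have := Fin.val_eq_div_of_monotone hF (fun a => ?_) (x i)
    · rwa [hgx, hf.map_mod_nat] at this
    -- A letter occurs at most `n` times: the rows following its occurrences lie in different
    -- blocks, and there are `n` blocks.
    · refine (Finset.card_le_card_of_injOn (t := Finset.range n)
        (fun p => (x (g p + 1) : ℕ) / k) ?_ ?_).trans_eq (Finset.card_range n)
      · intro p _
        exact Finset.mem_coe.2 (Finset.mem_range.2 (Nat.div_lt_of_lt_mul (x (g p + 1)).2))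
      · intro p hp q hq h
        simp only [Finset.coe_filter, Finset.mem_univ, true_and, Set.mem_ofPred_eq] at hp hq
        have := Nat.ModEq.add_right_cancel' 1 (hmod (hblock' h (hp.trans hq.symm)))
        exact g.injective (Fin.ext (this.eq_of_lt_of_lt (g p).2 (g q).2))
  refine ⟨fun i => x i, ⟨fun i => congrArg Fin.val (hxper i), fun i => (x i).2,
    fun y hy => ⟨g ⟨y, hy⟩, congrArg Fin.val (hxg _)⟩, fun i => ?_⟩, hlabel⟩
  have hlab : ∀ m : Fin n, (f i : ℕ) * n + m < k * n := fun m =>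
    calc (f i : ℕ) * n + m < (f i + 1) * n := by rw [add_mul, one_mul]; omega
      _ ≤ k * n := Nat.mul_le_mul_right n (f i).2
  let s : Fin n → ℕ := fun m => g ⟨f i * n + m, hlab m⟩
  have hxs : ∀ m, (x (s m) : ℕ) = f i * n + m := fun m => congrArg Fin.val (hxg _)
  have hfs : ∀ m, f (s m) = f i := fun m => Fin.ext (by
    rw [hlabel, hxs, mul_comm, Nat.mul_add_div hn, Nat.div_eq_of_lt m.2, add_zero])
  -- Among the `n` ranks with first letter `f i`, the block of the following row increases strictly
  -- with the residue, so it equals the residue.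
  have hstep : StrictMono fun m =>
      (⟨x (s m + 1) / k, Nat.div_lt_of_lt_mul (x _).2⟩ : Fin n) := by
    intro m m' hm
    have hff := (hfs m).trans (hfs m').symm
    have h1 : x (s m) < x (s m') := by
      rw [Fin.lt_def, hxs, hxs]
      exact Nat.add_lt_add_left hm _
    have h2 := hlt.1 (window_succ_lt (hlt.2 h1) hff)
    exact lt_of_le_of_ne (Nat.div_le_div_right (Fin.le_def.1 h2.le)) fun h =>
      h2.ne (hblock' (congrArg Fin.val h) hff)
  have hm : (x i : ℕ) % n < n := Nat.mod_lt _ hn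
  have h1 : x (s ⟨_, hm⟩) = x i := Fin.ext (by
    rw [hxs, hlabel, mul_comm]; exact Nat.div_add_mod _ _)
  have h2 : x (s ⟨_, hm⟩ + 1) = x (i + 1) := by
    rw [← hxper.map_mod_nat, (hmod h1).add_right 1, hxper.map_mod_nat]
  have h3 := congrArg Fin.val (Fin.eq_of_strictMono hstep ⟨_, hm⟩)
  simp only [h2] at h3
  exact h3

theorem exists_periodic_window {α : Type*} {N : ℕ} (hN : 0 < N) {l : List α} (hl : l.length = N) :
    ∃ f : ℕ → α, Function.Periodic f N ∧ window f N 0 = l := by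
  refine ⟨fun i => l[i % N]'((Nat.mod_lt i hN).trans_eq hl.symm), fun i => by simp only [Nat.add_mod_right], ?_⟩
  refine List.ext_getElem (by simp [window, hl]) fun i h1 h2 => ?_
  simp only [window, List.getElem_ofFn, zero_add]
  congr 1
  exact Nat.mod_eq_of_lt (hl ▸ h2)

theorem IsGeneralizedDeBruijnWord.exists_tour (hk : 1 < k) (hn : 0 < n) {c : Cycle (Fin k)}
    (hc : IsGeneralizedDeBruijnWord k n c) :
    ∃ x f, IsTour k n x ∧ IsLabel n x f ∧ c = ((window f (k * n) 0 : List (Fin k)) : Cycle (Fin k)) := by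
  have hN : 0 < k * n := by positivity
  induction c using Quotient.inductionOn' with
  | h l =>
  obtain ⟨hlen, hbwt⟩ := hc
  obtain ⟨f, hf, rfl⟩ := exists_periodic_window hN (l := l) hlen
  have hg := Tuple.monotone_sort fun i : Fin (k * n) => window f (k * n) i
  have hbwt' := bwt_window hf hN _ hg
  erw [hbwt'] at hbwt
  rw [isAlphabetPermutationPower_ofFn_iff hn] at hbwt
  obtain ⟨x, hx, hxf⟩ := exists_tour_of_rows hk hn hf _ hg hbwt
  exact ⟨x, f, hx, hxf, rfl⟩

end Tour

/-! ### Edge codes and degrees in the generalized de Bruijn graph -/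

open DirectedMultigraph

/-- The edge `(m, i)` of the generalized de Bruijn graph is encoded as `k * m + i`. -/
def edgeCode (k n : ℕ) : Fin n × Fin k ≃ Fin (k * n) :=
  finProdFinEquiv.trans (finCongr (mul_comm n k))

section EdgeCode

variable {k n : ℕ}

theorem edgeCode_val (e : Fin n × Fin k) : (edgeCode k n e : ℕ) = k * e.1 + e.2 :=
  add_comm _ _

theorem source_eq (e : Fin n × Fin k) :
    ((generalizedDeBruijnGraph k n).source e : ℕ) = edgeCode k n e / k := by
  rw [edgeCode_val, Nat.mul_add_div (e.2.pos), Nat.div_eq_of_lt e.2.2, add_zero]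
  rfl

theorem target_eq (e : Fin n × Fin k) :
    ((generalizedDeBruijnGraph k n).target e : ℕ) = edgeCode k n e % n := by
  rw [edgeCode_val]
  rfl

theorem card_outEdges_generalizedDeBruijnGraph (w : Fin n) :
    ((generalizedDeBruijnGraph k n).outEdges Finset.univ w).card = k := by
  have : (generalizedDeBruijnGraph k n).outEdges Finset.univ w = {w} ×ˢ Finset.univ := by
    ext e
    simp only [mem_outEdges, Finset.mem_univ, true_and, Finset.mem_product, Finset.mem_singleton,
      and_true]
    rfl
  rw [this, Finset.card_product, Finset.card_singleton, Finset.card_univ, Fintype.card_fin,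
    one_mul]

/-- The edges entering `w` are those with codes `a * n + w`, one for each label `a`. -/
theorem card_inEdges_generalizedDeBruijnGraph (w : Fin n) :
    ((generalizedDeBruijnGraph k n).inEdges Finset.univ w).card = k := by
  have hlt : ∀ a : Fin k, (a : ℕ) * n + w < k * n := fun a =>
    calc (a : ℕ) * n + w < (a + 1) * n := by rw [add_mul, one_mul]; omega
      _ ≤ k * n := Nat.mul_le_mul_right n a.2
  refine (Eq.trans (Finset.card_bij (s := (Finset.univ : Finset (Fin k))) (fun a _ => (edgeCode k n).symm ⟨a * n + w, hlt a⟩)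
    ?_ ?_ ?_).symm (Finset.card_fin k))
  · intro a _
    rw [mem_inEdges, Fin.ext_iff, target_eq, Equiv.apply_symm_apply]
    exact ⟨Finset.mem_univ _, by
      rw [Nat.mul_add_mod_self_right, Nat.mod_eq_of_lt w.2]⟩
  · intro a _ b _ h
    have := congrArg Fin.val ((edgeCode k n).symm.injective h)
    simp only [Nat.add_right_cancel_iff] at this
    exact Fin.ext (Nat.eq_of_mul_eq_mul_right w.pos this)
  · intro e he
    rw [mem_inEdges, Fin.ext_iff, target_eq] at he
    refine ⟨⟨edgeCode k n e / n, Nat.div_lt_of_lt_mul ?_⟩, Finset.mem_univ _, ?_⟩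
    · exact (edgeCode k n e).2.trans_eq (mul_comm _ _)
    · rw [Equiv.symm_apply_eq, Fin.ext_iff]
      exact (congrArg (edgeCode k n e / n * n + ·) he.2.symm).trans (Nat.div_add_mod' _ _)

end EdgeCode

/-! ### Eulerian trails and necklaces -/

theorem DirectedMultigraph.isWalk_iff {V E : Type*} {G : DirectedMultigraph V E} {r v : V}
    {l : List E} : G.IsWalk r v l ↔ v :: l.map G.target = l.map G.source ++ [r] := by
  induction l generalizing v with
  | nil => simp [IsWalk]
  | cons e l ih =>
    rw [IsWalk, ih, List.map_cons, List.map_cons, List.cons_append, List.cons.injEq]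
    exact and_congr_left' eq_comm

/-- Closedness turns the walk condition into a cyclic one, suited to periodic sequences. -/
theorem DirectedMultigraph.isWalk_target_iff {V E : Type*} {G : DirectedMultigraph V E} {e : E}
    {l : List E} : G.IsWalk (G.source e) (G.target e) l ↔
      (e :: l).map G.target = ((e :: l).map G.source).rotate 1 := by
  rw [isWalk_iff, List.map_cons, List.map_cons, List.rotate_cons_succ, List.rotate_zero]

section Correspondence

variable {k n : ℕ}

/-- The closed trails through all edges of `DB(k, n)` that start with `e`, without their first
edge. -/
noncomputable def eulerTrails (k n : ℕ) (e : Fin n × Fin k) : Finset (List (Fin n × Fin k)) :=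
  (generalizedDeBruijnGraph k n).trails ((generalizedDeBruijnGraph k n).source e)
    ((generalizedDeBruijnGraph k n).target e) (Finset.univ.erase e)

/-- The label of an edge. -/
def edgeLabel (k n : ℕ) (e : Fin n × Fin k) : Fin k :=
  ⟨edgeCode k n e / n, Nat.div_lt_of_lt_mul ((edgeCode k n e).2.trans_eq (mul_comm _ _))⟩

/-- The word spelled by a closed trail. -/
def trailWord (e : Fin n × Fin k) (l : List (Fin n × Fin k)) : List (Fin k) :=
  (e :: l).map (edgeLabel k n)

theorem mem_eulerTrails {e : Fin n × Fin k} {l : List (Fin n × Fin k)} :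
    l ∈ eulerTrails k n e ↔ (Finset.univ : Finset (Fin n × Fin k)).val = (e :: l : List _) ∧
      (e :: l).map (generalizedDeBruijnGraph k n).target =
        ((e :: l).map (generalizedDeBruijnGraph k n).source).rotate 1 := by
  rw [eulerTrails, mem_trails, isWalk_target_iff, Finset.erase_val, ← Multiset.cons_coe]
  refine and_congr_left' ⟨fun h => ?_, fun h => ?_⟩
  · rw [← h, Multiset.cons_erase (Finset.mem_univ e)]
  · rw [h, Multiset.erase_cons_head]

theorem isTour_iff {h : ℕ → Fin n × Fin k} (hN : 0 < k * n) (hh : Function.Periodic h (k * n)) :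
    IsTour k n (fun i => edgeCode k n (h i)) ↔
      (Finset.univ : Finset (Fin n × Fin k)).val = (window h (k * n) 0 : List _) ∧
      (window h (k * n) 0).map (generalizedDeBruijnGraph k n).target =
        ((window h (k * n) 0).map (generalizedDeBruijnGraph k n).source).rotate 1 := by
  have hcomp : ∀ {α : Type} (g : Fin n × Fin k → α), Function.Periodic (g ∘ h) (k * n) :=
    fun g => hh.comp g
  rw [window_map, window_map, window_rotate (hcomp _), window_eq_iff (hcomp _) (hcomp _) hN]
  have hstep : ∀ t, (generalizedDeBruijnGraph k n).target (h (0 + t)) =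
      (generalizedDeBruijnGraph k n).source (h (1 + t)) ↔
      (edgeCode k n (h (t + 1)) : ℕ) / k = edgeCode k n (h t) % n := fun t => by
    rw [Fin.ext_iff, target_eq, source_eq, zero_add, add_comm 1, eq_comm]
  constructor
  · intro hx
    refine ⟨?_, fun t => (hstep t).2 (hx.step t)⟩
    have hinj : Function.Injective fun i : Fin (k * n) => h (0 + i) := fun i j hij => by
      simp only [zero_add] at hij
      exact hx.bijective.injective (Fin.ext (by simp only [hij]))
    have hnd : (window h (k * n) 0).Nodup := List.nodup_ofFn.2 hinj
    have : (⟨(window h (k * n) 0 : List _), hnd⟩ : Finset (Fin n × Fin k)) = Finset.univ := by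
      rw [Finset.eq_univ_iff_forall]
      intro e
      obtain ⟨i, hi, hie⟩ := hx.exists_lt (edgeCode k n e).2
      have hie' : h i = e := (edgeCode k n).injective (Fin.ext hie)
      refine List.mem_ofFn.2 ⟨⟨i, hi⟩, ?_⟩
      rw [zero_add]
      exact hie'
    rw [← this]
  · rintro ⟨h1, h2⟩
    refine ⟨fun i => congrArg (fun e => (edgeCode k n e : ℕ)) (hh i), fun i => (edgeCode k n _).2,
      fun y hy => ?_, fun t => (hstep t).1 (h2 t)⟩
    have : (edgeCode k n).symm ⟨y, hy⟩ ∈ (Finset.univ : Finset (Fin n × Fin k)).val :=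
      Finset.mem_univ _
    rw [h1] at this
    obtain ⟨i, hi⟩ := List.mem_ofFn.1 this
    refine ⟨0 + i, ?_⟩
    rw [hi, Equiv.apply_symm_apply]

theorem length_of_mem_eulerTrails {e : Fin n × Fin k} {l : List (Fin n × Fin k)}
    (hl : l ∈ eulerTrails k n e) : (e :: l).length = k * n := by
  have := congrArg Multiset.card (mem_eulerTrails.1 hl).1
  rw [Multiset.coe_card] at this
  rw [← this, Finset.card_val, Finset.card_univ, Fintype.card_prod, Fintype.card_fin,
    Fintype.card_fin, mul_comm]

theorem isLabel_edgeLabel (h : ℕ → Fin n × Fin k) :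
    IsLabel n (fun i => edgeCode k n (h i)) (edgeLabel k n ∘ h) := fun _ => rfl

theorem exists_tour_of_mem_eulerTrails {e : Fin n × Fin k} {l : List (Fin n × Fin k)}
    (hl : l ∈ eulerTrails k n e) : ∃ h : ℕ → Fin n × Fin k,
      IsTour k n (fun i => edgeCode k n (h i)) ∧ window h (k * n) 0 = e :: l ∧ h 0 = e := by
  have hN : 0 < k * n := (length_of_mem_eulerTrails hl) ▸ Nat.succ_pos _
  obtain ⟨h, hh, hw⟩ := exists_periodic_window hN (length_of_mem_eulerTrails hl)
  refine ⟨h, (isTour_iff hN hh).2 (hw ▸ mem_eulerTrails.1 hl), hw, ?_⟩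
  have := congrArg (fun w => w[0]?) hw
  simpa [window, hN] using this

theorem trailWord_eq {e : Fin n × Fin k} {l : List (Fin n × Fin k)} {h : ℕ → Fin n × Fin k}
    (hw : window h (k * n) 0 = e :: l) :
    trailWord e l = window (edgeLabel k n ∘ h) (k * n) 0 := by
  rw [trailWord, ← hw, window_map]

theorem image_eulerTrails (hk : 1 < k) (hn : 0 < n) (e : Fin n × Fin k) :
    (fun l => (trailWord e l : Cycle (Fin k))) '' (eulerTrails k n e : Set (List _)) =
      {c | IsGeneralizedDeBruijnWord k n c} := by
  ext c
  constructor
  · rintro ⟨l, hl, rfl⟩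
    obtain ⟨h, hx, hw, -⟩ := exists_tour_of_mem_eulerTrails hl
    have := hx.isGeneralizedDeBruijnWord (isLabel_edgeLabel h)
    rw [← trailWord_eq hw] at this
    exact this
  · intro hc
    obtain ⟨x, f, hx, hf, rfl⟩ := IsGeneralizedDeBruijnWord.exists_tour hk hn hc
    -- Start the tour at its passage through `e`; this only rotates the word.
    obtain ⟨s, hs⟩ := hx.surj _ (edgeCode k n e).2
    let h : ℕ → Fin n × Fin k := fun i => (edgeCode k n).symm ⟨x (i + s), hx.lt _⟩
    have hcode : (fun i => (edgeCode k n (h i) : ℕ)) = fun i => x (i + s) := by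
      funext i
      simp only [h, Equiv.apply_symm_apply]
    have hx' : IsTour k n (fun i => edgeCode k n (h i)) := hcode ▸ hx.shift s
    have hh : Function.Periodic h (k * n) := fun i =>
      (edgeCode k n).injective (Fin.ext (hx'.periodic i))
    have h0 : h 0 = e := by
      simp only [h, Equiv.symm_apply_eq, zero_add]
      exact Fin.ext hs
    have hw : window h (k * n) 0 = e :: (window h (k * n) 0).tail := by
      have hne : window h (k * n) 0 ≠ [] :=
        List.ne_nil_of_length_pos (by simpa [window] using hx.pos)
      have hhead : (window h (k * n) 0).head hne = e := by
        rw [List.head_eq_getElem]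
        simp [window, h0]
      conv_lhs => rw [← List.cons_head_tail hne, hhead]
    refine ⟨(window h (k * n) 0).tail, ?_, ?_⟩
    · rw [Finset.mem_coe, mem_eulerTrails, ← hw]
      exact (isTour_iff hx.pos hh).1 hx'
    · have hlab : edgeLabel k n ∘ h = fun i => f (s + i) := by
        funext i
        refine Fin.ext ((isLabel_edgeLabel h i).trans ?_)
        rw [hf, add_comm s]
        exact congrArg (· / n) (congrFun hcode i)
      simp only [trailWord_eq hw]
      rw [Cycle.coe_eq_coe]
      refine List.IsRotated.symm ⟨s, ?_⟩
      rw [window_rotate (hf.periodic hx), hlab]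
      simp only [window, zero_add]

/-- Words equal up to a rotation by `s` give tours equal up to a shift by `s`, because labels
determine tours. Both tours start with `e`, which occurs once per period, so the shift is trivial.
-/
theorem injOn_trailWord (e : Fin n × Fin k) :
    Set.InjOn (fun l => (trailWord e l : Cycle (Fin k))) (eulerTrails k n e : Set (List _)) := by
  intro l hl l' hl' heq
  obtain ⟨h, hx, hw, h0⟩ := exists_tour_of_mem_eulerTrails hl
  obtain ⟨h', hx', hw', h0'⟩ := exists_tour_of_mem_eulerTrails hl'
  have hf := isLabel_edgeLabel h
  have hf' := isLabel_edgeLabel h'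
  simp only [trailWord_eq hw, trailWord_eq hw'] at heq
  obtain ⟨s, hs⟩ := Cycle.coe_eq_coe.1 heq
  rw [window_rotate (hf.periodic hx), window_eq_iff (hf.periodic hx) (hf'.periodic hx') hx.pos] at hs
  have heq' := (hx.shift s).eq_of_label hx' (f := edgeLabel k n ∘ h') (fun i => by
    rw [← zero_add i, ← hs, add_comm s, zero_add]
    rfl) hf'
  have hmod := hx.modEq (i := s) (j := 0) (by
    rw [h0, ← h0', ← congrFun heq' 0, zero_add])
  have hhh : h = h' := by
    funext i
    refine (edgeCode k n).injective (Fin.ext ?_)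
    rw [← congrFun heq' i]
    have := hx.periodic.map_mod_nat (i + s)
    rw [hmod.add_left i, hx.periodic.map_mod_nat] at this
    exact this
  subst hhh
  exact List.tail_eq_of_cons_eq (hw.symm.trans hw')

end Correspondence

theorem mainTheorem2 (k n : ℕ) (hk : 1 < k) (hn : 1 ≤ n) (r : Fin n) :
    {c : Cycle (Fin k) | IsGeneralizedDeBruijnWord k n c}.ncard =
      (Nat.factorial (k - 1)) ^ n *
        (generalizedDeBruijnGraph k n).numOrientedSpanningTrees r := by
  -- Any edge leaving `r` would do: its source becomes the root.
  let e : Fin n × Fin k := (r, ⟨0, by omega⟩)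
  rw [← image_eulerTrails hk hn e, (injOn_trailWord e).ncard_image, Set.ncard_coe_finset,
    eulerTrails, card_eulerian (by omega) card_outEdges_generalizedDeBruijnGraph
      card_inEdges_generalizedDeBruijnGraph, Fintype.card_fin]
  rfl
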